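/- Throughout, Euclidean spaces are finite-dimensional real inner product spaces and $\|\cdot\|$ is the norm induced by the inner product $\langle\cdot,\cdot\rangle$. A Euclidean Jordan algebra is a Euclidean space $\mathbb X$ with a commutative bilinear product $\circ$ satisfying $(x\circ y)\circ(x\circ x)=x\circ(y\circ(x\circ x))$ and $\langle x\circ y,z\rangle=\langle y,x\circ z\rangle$ for all $x,y,z\in\mathbb X$, and with a unit element $e_{\mathbb X}$. Its symmetric cone is $K_{\mathbb X}=\{x\circ x:x\in\mathbb X\}$. A primitive idempotent is an element $c\ne 0$ with $c\circ c=c$ that is not the sum of two nonzero idempotents. The dual cone of a subset $K$ of a Euclidean space $\mathbb V$ is $K^*=\{\zeta\in\mathbb V:\langle\zeta,u\rangle\ge 0\ \forall u\in K\}$. Let $\mathbb V$ be a Euclidean space, let $\mathbb X,\mathbb Y$ be Euclidean Jordan algebras, let $G:\mathbb X\to\mathbb V$ and $H:\mathbb Y\to\mathbb V$ be linear, and let $P=G(K_{\mathbb X})$ and $Q=H(K_{\mathbb Y})$ be LISC cones, that is: $P$ and $Q$ are closed convex cones; $G(c)\neq0$ for every primitive idempotent $c$ of $\mathbb X$ and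 $H(d)\ne0$ for every primitive idempotent $d$ of $\mathbb Y$; and $P\cap(-P)=\{0\}$, $Q\cap(-Q)=\{0\}$. Consider the fractional program $$\text{(FP)}\qquad \min\ \Phi(x,y):=\frac{\langle Gx,Hy\rangle}{\|Gx\|\,\|Hy\|}\quad\text{s.t. } x\in K_{\mathbb X},\ \langle e_{\mathbb X},x\rangle=1,\quad y\in K_{\mathbb Y},\ \langle e_{\mathbb Y},y\rangle=1.$$ A solution of (FP) is a feasible pair that minimizes $\Phi$ over all feasible pairs. A stationary point of (FP) is a feasible pair $(\tilde x,\tilde y)$ at which $\Phi$ is differentiable and for which there are $\gamma_1,\gamma_2\in\mathbb R$ such that $\nabla_x\Phi(\tilde x,\tilde y)+\gamma_1e_{\mathbb X}$ lies in $K_{\mathbb X}^*$ and is orthogonal to $\tilde x$, and $\nabla_y\Phi(\tilde x,\tilde y)+\gamma_2e_{\mathbb Y}$ lies in $K_{\mathbb Y}^*$ and is orthogonal to $\tilde y$. A pair $(u,v)$ with $u\in P$, $v\in Q$, $\|u\|=\|v\|=1$ is a critical pair of $(P,Q)$ if $v-\langle u,v\rangle u\in P^*$ and $u-\langle u,v\rangle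 v\in Q^*$; it is an antipodal pair of $(P,Q)$ if it minimizes $\langle u,v\rangle$ over all unit vectors $u\in P$ and $v\in Q$. If $(\tilde x,\tilde y)$ is a stationary point (resp. a solution) of (FP), then $$(u,v)=\left(\frac{G\tilde x}{\|G\tilde x\|},\frac{H\tilde y}{\|H\tilde y\|}\right)\qquad(*)$$ is a critical (resp. antipodal) pair of $(P,Q)$. Conversely, if $(u,v)$ is a critical pair of $(P,Q)$, then there is a stationary point $(\tilde x,\tilde y)$ of (FP) such that $(*)$ holds; and if $(u,v)$ is an antipodal pair of $(P,Q)$, then there is a solution $(\tilde x,\tilde y)$ of (FP), which is also a stationary point of (FP), such that $(*)$ holds. -/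

import Mathlib

open scoped RealInnerProductSpace

/-- A Euclidean Jordan algebra: a finite-dimensional real inner product space with a commutative
bilinear product satisfying the Jordan identity `(x * y) * (x * x) = x * (y * (x * x))`
(Mathlib's `IsCommJordan`), a unit element, and an inner product that is associative with respect
to the product. -/
class EuclideanJordanAlgebra (X : Type*) [NormedAddCommGroup X] [InnerProductSpace ℝ X]
    [FiniteDimensional ℝ X] extends CommMagma X, One X, IsCommJordan X where
  protected mul_add : ∀ x y z : X, x * (y + z) = x * y + x * z
  protected mul_smul : ∀ (a : ℝ) (x y : X), x * (a • y) = a • (x * y)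
  protected one_mul : ∀ x : X, 1 * x = x
  inner_mul : ∀ x y z : X, ⟪x * y, z⟫ = ⟪y, x * z⟫

section JordanAlgebra

variable (X : Type*) [NormedAddCommGroup X] [InnerProductSpace ℝ X] [FiniteDimensional ℝ X]
  [EuclideanJordanAlgebra X]

/-- The symmetric cone of a Euclidean Jordan algebra: its cone of squares. -/
def symmetricCone : Set X := {x | ∃ z : X, x = z * z}

variable {X}

/-- A primitive idempotent: a nonzero idempotent that is not the sum of two nonzero idempotents. -/
def IsPrimitiveIdempotent (c : X) : Prop :=
  c ≠ 0 ∧ c * c = c ∧ ¬ ∃ a b : X, a ≠ 0 ∧ b ≠ 0 ∧ a * a = a ∧ b * b = b ∧ c = a + b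

/-- `IsLISC P G`: the closed convex cone `P` is a LISC cone (linear image of a symmetric cone),
represented as `P = G(K_X)`. A `ProperCone ℝ V` is a nonempty closed convex cone in `V`. -/
structure IsLISC {V : Type*} [NormedAddCommGroup V] [InnerProductSpace ℝ V]
    (P : ProperCone ℝ V) (G : X →ₗ[ℝ] V) : Prop where
  image_eq : G '' symmetricCone X = (P : Set V)
  map_ne_zero : ∀ c : X, IsPrimitiveIdempotent c → G c ≠ 0
  pointed : ∀ u : V, u ∈ P → -u ∈ P → u = 0

end JordanAlgebra

section Angles

variable {V : Type*} [NormedAddCommGroup V] [InnerProductSpace ℝ V]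

/-- The pairs of unit vectors `(u, v)` with `u ∈ P` and `v ∈ Q`. -/
def unitPairs (P Q : ProperCone ℝ V) : Set (V × V) :=
  {p | (p.1 ∈ P ∧ ‖p.1‖ = 1) ∧ (p.2 ∈ Q ∧ ‖p.2‖ = 1)}

/-- An antipodal pair of `(P, Q)`: a minimizer of `⟪u, v⟫` over unit vectors `u ∈ P`, `v ∈ Q`. -/
def IsAntipodalPair (P Q : ProperCone ℝ V) (u v : V) : Prop :=
  (u, v) ∈ unitPairs P Q ∧ IsMinOn (fun p : V × V => ⟪p.1, p.2⟫) (unitPairs P Q) (u, v)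

/-- A critical pair of `(P, Q)`. -/
structure IsCriticalPair [CompleteSpace V] (P Q : ProperCone ℝ V) (u v : V) : Prop where
  mem_left : u ∈ P
  norm_left : ‖u‖ = 1
  mem_right : v ∈ Q
  norm_right : ‖v‖ = 1
  dual_left : v - ⟪u, v⟫ • u ∈ ProperCone.innerDual (P : Set V)
  dual_right : u - ⟪u, v⟫ • v ∈ ProperCone.innerDual (Q : Set V)

end Angles

section Optimization

variable {X Y : Type*} [NormedAddCommGroup X] [InnerProductSpace ℝ X] [CompleteSpace X]
  [NormedAddCommGroup Y] [InnerProductSpace ℝ Y] [CompleteSpace Y]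

/-- The feasible set `{(x, y) : x ∈ K, φ₁ x = 0, y ∈ L, φ₂ y = 0}`. -/
def feasibleSet (K : Set X) (L : Set Y) (φ₁ : X → ℝ) (φ₂ : Y → ℝ) : Set (X × Y) :=
  {p | (p.1 ∈ K ∧ φ₁ p.1 = 0) ∧ (p.2 ∈ L ∧ φ₂ p.2 = 0)}

/-- `(x, y)` is a (global) solution of: minimize `Ψ` subject to `x ∈ K, φ₁ x = 0, y ∈ L, φ₂ y = 0`.
-/
def IsSolution (K : Set X) (L : Set Y) (Ψ : X × Y → ℝ) (φ₁ : X → ℝ) (φ₂ : Y → ℝ)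
    (x : X) (y : Y) : Prop :=
  (x, y) ∈ feasibleSet K L φ₁ φ₂ ∧ IsMinOn Ψ (feasibleSet K L φ₁ φ₂) (x, y)

/-- `(x, y)` is a stationary point of: minimize `Ψ` subject to
`x ∈ K, φ₁ x = 0, y ∈ L, φ₂ y = 0`. The differentiability that the gradients presuppose is part of
the definition. -/
structure IsStationaryPoint (K : Set X) (L : Set Y) (Ψ : X × Y → ℝ) (φ₁ : X → ℝ) (φ₂ : Y → ℝ)
    (x : X) (y : Y) : Prop where
  differentiableAt : DifferentiableAt ℝ Ψ (x, y)
  differentiableAt_left : DifferentiableAt ℝ φ₁ x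
  differentiableAt_right : DifferentiableAt ℝ φ₂ y
  feasible : (x, y) ∈ feasibleSet K L φ₁ φ₂
  multiplier_left : ∃ γ : ℝ,
    ⟪x, gradient (fun x' => Ψ (x', y)) x + γ • gradient φ₁ x⟫ = 0 ∧
    gradient (fun x' => Ψ (x', y)) x + γ • gradient φ₁ x ∈ ProperCone.innerDual K
  multiplier_right : ∃ γ : ℝ,
    ⟪y, gradient (fun y' => Ψ (x, y')) y + γ • gradient φ₂ y⟫ = 0 ∧
    gradient (fun y' => Ψ (x, y')) y + γ • gradient φ₂ y ∈ ProperCone.innerDual L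

end Optimization

section FractionalProgram

variable {V X Y : Type*} [NormedAddCommGroup V] [InnerProductSpace ℝ V]
  [NormedAddCommGroup X] [InnerProductSpace ℝ X] [FiniteDimensional ℝ X]
  [EuclideanJordanAlgebra X]
  [NormedAddCommGroup Y] [InnerProductSpace ℝ Y] [FiniteDimensional ℝ Y]
  [EuclideanJordanAlgebra Y]

/-- The fractional objective `Φ(x, y) = ⟪G x, H y⟫ / (‖G x‖ ‖H y‖)`. -/
noncomputable def fracObjective (G : X →ₗ[ℝ] V) (H : Y →ₗ[ℝ] V) (p : X × Y) : ℝ :=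
  ⟪G p.1, H p.2⟫ / (‖G p.1‖ * ‖H p.2‖)

/-- The constraint function `x ↦ ⟪e, x⟫ - 1` of the spectraplex. -/
noncomputable def traceConstraint (x : X) : ℝ := ⟪(1 : X), x⟫ - 1

/-- `(x, y)` is a solution of the fractional program: minimize `Φ(x, y)` subject to
`x ∈ K_X, ⟪e_X, x⟫ = 1, y ∈ K_Y, ⟪e_Y, y⟫ = 1`. -/
def IsFracSolution (G : X →ₗ[ℝ] V) (H : Y →ₗ[ℝ] V) (x : X) (y : Y) : Prop :=
  IsSolution (symmetricCone X) (symmetricCone Y) (fracObjective G H)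
    traceConstraint traceConstraint x y

/-- `(x, y)` is a stationary point of the fractional program. -/
def IsFracStationaryPoint (G : X →ₗ[ℝ] V) (H : Y →ₗ[ℝ] V) (x : X) (y : Y) : Prop :=
  haveI : CompleteSpace X := FiniteDimensional.complete ℝ X
  haveI : CompleteSpace Y := FiniteDimensional.complete ℝ Y
  IsStationaryPoint (symmetricCone X) (symmetricCone Y) (fracObjective G H)
    traceConstraint traceConstraint x y

end FractionalProgram

namespace EuclideanJordanAlgebra

open Polynomial

variable {X : Type*} [NormedAddCommGroup X] [InnerProductSpace ℝ X] [FiniteDimensional ℝ X]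
  [EuclideanJordanAlgebra X]

/-- The underlying nonassociative commutative ring of a Euclidean Jordan algebra. -/
abbrev toNonUnitalNonAssocCommRing (X : Type*) [NormedAddCommGroup X] [InnerProductSpace ℝ X]
    [FiniteDimensional ℝ X] [EuclideanJordanAlgebra X] : NonUnitalNonAssocCommRing X :=
  { (inferInstance : AddCommGroup X), (inferInstance : CommMagma X) with
    left_distrib := EuclideanJordanAlgebra.mul_add
    right_distrib := fun a b c => by
      rw [mul_comm (a + b), EuclideanJordanAlgebra.mul_add, mul_comm c, mul_comm c]
    zero_mul := fun a => by
      rw [mul_comm]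
      simpa using EuclideanJordanAlgebra.mul_smul 0 a a
    mul_zero := fun a => by simpa using EuclideanJordanAlgebra.mul_smul 0 a a }

variable (X) in
/-- The product as a bilinear map. -/
def lmul : X →ₗ[ℝ] X →ₗ[ℝ] X :=
  letI := toNonUnitalNonAssocCommRing X
  LinearMap.mk₂ ℝ (fun x y => x * y) add_mul
    (fun a x y => by rw [mul_comm, EuclideanJordanAlgebra.mul_smul, mul_comm])
    EuclideanJordanAlgebra.mul_add EuclideanJordanAlgebra.mul_smul

@[simp]
theorem lmul_apply (x y : X) : lmul X x y = x * y := rfl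

theorem jordan_mul_one (x : X) : x * 1 = x := by
  rw [mul_comm, EuclideanJordanAlgebra.one_mul]

theorem lmul_one : lmul X 1 = 1 := by
  ext x
  simp [EuclideanJordanAlgebra.one_mul]

theorem lmul_isSymmetric (x : X) : (lmul X x).IsSymmetric := fun y z => by
  simpa using inner_mul x y z

theorem inner_one_mul_self (z : X) : ⟪(1 : X), z * z⟫ = ‖z‖ ^ 2 := by
  rw [← inner_mul z 1 z, jordan_mul_one, real_inner_self_eq_norm_sq]

theorem lmul_linearized (a b c d : X) :
    a * ((b * c) * d) - (b * c) * (a * d) + (b * ((c * a) * d) - (c * a) * (b * d))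
      + (c * ((a * b) * d) - (a * b) * (c * d)) = 0 := by
  let := toNonUnitalNonAssocCommRing X
  have h := two_nsmul_lie_lmul_lmul_add_add_eq_zero a b c
  have h' := DFunLike.congr_fun h d
  have h2 : 2 • (a * ((b * c) * d) - (b * c) * (a * d) + (b * ((c * a) * d) - (c * a) * (b * d))
      + (c * ((a * b) * d) - (a * b) * (c * d))) = 0 := h'
  rw [← Nat.cast_smul_eq_nsmul ℝ] at h2
  exact (smul_eq_zero.1 h2).resolve_left (by norm_num)

theorem commute_lmul_mul_self (z : X) : Commute (lmul X z) (lmul X (z * z)) := by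
  ext x
  have h := IsCommJordan.lmul_comm_rmul_rmul z x
  simp only [Module.End.mul_apply, lmul_apply]
  rw [mul_comm (z * z) x, ← h, mul_comm]

theorem lmul_mul_mul (z w : X) :
    lmul X (z * (z * w)) = -(lmul X z * lmul X z * lmul X w) + lmul X (z * z) * lmul X w
      + (2 : ℝ) • (lmul X (z * w) * lmul X z) - lmul X w * lmul X z * lmul X z := by
  ext x
  have h := lmul_linearized z x w z
  simp only [Module.End.mul_apply, lmul_apply, LinearMap.sub_apply, LinearMap.add_apply,
    LinearMap.neg_apply, LinearMap.smul_apply]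
  simp only [mul_comm] at h ⊢
  linear_combination (norm := module) h

theorem commute_lmul_pow (z : X) (n : ℕ) :
    Commute (lmul X z) (lmul X ((lmul X z ^ n) 1)) := by
  induction n using Nat.twoStepInduction with
  | zero => simp [lmul_one]
  | one => simp [jordan_mul_one]
  | more n h0 h1 =>
    have hz := Commute.refl (lmul X z)
    rw [pow_succ', Module.End.mul_apply, lmul_apply] at h1
    rw [pow_succ', pow_succ', Module.End.mul_apply, Module.End.mul_apply, lmul_apply, lmul_apply,
      lmul_mul_mul]
    exact ((((hz.mul_right hz).mul_right h0).neg_right.add_right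
      ((commute_lmul_mul_self z).mul_right h0)).add_right
      ((h1.mul_right hz).smul_right 2)).sub_right ((h0.mul_right hz).mul_right hz)

theorem commute_lmul_aeval (z : X) (p : ℝ[X]) :
    Commute (lmul X z) (lmul X (aeval (lmul X z) p 1)) := by
  induction p using Polynomial.induction_on' with
  | add p q hp hq => simpa using hp.add_right hq
  | monomial n a =>
    rw [aeval_monomial]
    simpa [Algebra.algebraMap_eq_smul_one] using (commute_lmul_pow z n).smul_right a

/-- Polynomials in a single element multiply associatively. -/
theorem aeval_mul_aeval (z : X) (p q : ℝ[X]) :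
    aeval (lmul X z) p 1 * aeval (lmul X z) q 1 = aeval (lmul X z) (p * q) 1 := by
  have h : Commute (aeval (lmul X z) q) (lmul X (aeval (lmul X z) p 1)) := by
    induction q using Polynomial.induction_on' with
    | add p q hp hq => simpa using hp.add_left hq
    | monomial n a =>
      rw [aeval_monomial]
      exact (Algebra.commute_algebraMap_left a _).mul_left ((commute_lmul_aeval z p).pow_left n)
  have h1 := DFunLike.congr_fun h.eq 1
  simp only [Module.End.mul_apply, lmul_apply, jordan_mul_one] at h1
  rw [← h1, mul_comm p q, map_mul, Module.End.mul_apply]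

end EuclideanJordanAlgebra

theorem LinearMap.IsSymmetric.aeval_eq_zero {E : Type*} [NormedAddCommGroup E]
    [InnerProductSpace ℝ E] [FiniteDimensional ℝ E] {T : E →ₗ[ℝ] E} (hT : T.IsSymmetric)
    {p : Polynomial ℝ} (hp : ∀ i, p.eval (hT.eigenvalues rfl i) = 0) :
    Polynomial.aeval T p = 0 := by
  refine (hT.eigenvectorBasis rfl).toBasis.ext fun i => ?_
  rw [OrthonormalBasis.coe_toBasis,
    Module.End.aeval_apply_of_hasEigenvector (hT.hasEigenvector_eigenvectorBasis rfl i)]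
  simp [hp i]

namespace EuclideanJordanAlgebra

open Polynomial

variable {X : Type*} [NormedAddCommGroup X] [InnerProductSpace ℝ X] [FiniteDimensional ℝ X]
  [EuclideanJordanAlgebra X]

/-- A nonzero element has a nonzero spectral idempotent with nonzero eigenvalue. -/
theorem exists_idempotent_mul_eq_smul {z : X} (hz : z ≠ 0) :
    ∃ (μ : ℝ) (c : X), μ ≠ 0 ∧ c ≠ 0 ∧ c * c = c ∧ z * c = μ • c := by
  set T := lmul X z with hTdef
  have hT : T.IsSymmetric := lmul_isSymmetric z
  set s : Finset ℝ := Finset.univ.image (hT.eigenvalues rfl) with hs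
  have hmem : ∀ i, hT.eigenvalues rfl i ∈ s := fun i => by simp [hs]
  have hinj : Set.InjOn (id : ℝ → ℝ) s := Function.injective_id.injOn
  have hbasis : ∀ μ ∈ s, ∀ ν ∈ s, (Lagrange.basis s id μ).eval ν = if μ = ν then 1 else 0 := by
    intro μ hμ ν hν
    split_ifs with h
    · subst h; exact Lagrange.eval_basis_self hinj hμ
    · exact Lagrange.eval_basis_of_ne (v := id) h hν
  have hsum : z = ∑ μ ∈ s, μ • aeval T (Lagrange.basis s id μ) 1 := by
    have h : aeval T (Polynomial.X - ∑ μ ∈ s, C μ * Lagrange.basis s id μ) = 0 := by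
      refine hT.aeval_eq_zero fun i => ?_
      simp only [eval_sub, eval_X, eval_finsetSum, eval_mul, eval_C]
      rw [Finset.sum_congr rfl fun μ hμ => by rw [hbasis μ hμ _ (hmem i)]]
      simp [hmem i]
    have h1 := DFunLike.congr_fun h 1
    simpa [sub_eq_zero, hTdef, jordan_mul_one, LinearMap.sum_apply, Algebra.algebraMap_eq_smul_one]
      using h1
  obtain ⟨μ, hμ, hne⟩ := Finset.exists_ne_zero_of_sum_ne_zero (hsum ▸ hz)
  obtain ⟨h0, hc⟩ := smul_ne_zero_iff.1 hne
  refine ⟨μ, _, h0, hc, ?_, ?_⟩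
  · rw [aeval_mul_aeval, ← sub_eq_zero, ← LinearMap.sub_apply, ← map_sub]
    rw [hT.aeval_eq_zero, LinearMap.zero_apply]
    intro i
    simp only [eval_sub, eval_mul, hbasis μ hμ _ (hmem i)]
    split_ifs <;> simp
  · have h : aeval T ((Polynomial.X - C μ) * Lagrange.basis s id μ) = 0 := by
      refine hT.aeval_eq_zero fun i => ?_
      simp only [eval_sub, eval_mul, hbasis μ hμ _ (hmem i), eval_X, eval_C]
      split_ifs with h <;> simp [h]
    have h1 := DFunLike.congr_fun h 1
    simpa [sub_eq_zero, hTdef, Algebra.algebraMap_eq_smul_one] using h1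

theorem sub_sq_smul_mem_symmetricCone {z c : X} {μ : ℝ} (hc : c * c = c) (hzc : z * c = μ • c) :
    z * z - μ ^ 2 • c ∈ symmetricCone X := by
  refine ⟨z - μ • c, ?_⟩
  rw [← lmul_apply (z - μ • c)]
  simp only [map_sub, map_smul, LinearMap.sub_apply, LinearMap.smul_apply, lmul_apply,
    mul_comm c z, hc, hzc]
  module

theorem isClosed_idempotent_ne_zero : IsClosed {c : X | c * c = c ∧ c ≠ 0} := by
  set B := (lmul X).toContinuousBilinearMap with hB
  have hBa : ∀ x y : X, B x y = x * y := fun _ _ => rfl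
  have hset : {c : X | c * c = c ∧ c ≠ 0} = {c : X | B c c = c ∧ 1 ≤ ‖B‖ * ‖c‖} := by
    ext c
    simp only [Set.mem_ofPred_eq, hBa]
    refine and_congr_right fun h => ⟨fun h0 => ?_, fun h1 h0 => ?_⟩
    · have := B.le_opNorm₂ c c
      rw [hBa, h] at this
      have hpos : 0 < ‖c‖ := norm_pos_iff.2 h0
      exact le_of_mul_le_mul_right (by linarith) hpos
    · rw [h0, norm_zero, mul_zero] at h1
      linarith
  rw [hset]
  exact (isClosed_eq (f := fun c => B c c) (by fun_prop) continuous_id).inter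
    (isClosed_le (g := fun c => ‖B‖ * ‖c‖) continuous_const (by fun_prop))

end EuclideanJordanAlgebra

section Kernel

open EuclideanJordanAlgebra

variable {X : Type*} [NormedAddCommGroup X] [InnerProductSpace ℝ X] [FiniteDimensional ℝ X]
  [EuclideanJordanAlgebra X]

theorem symmetricCone_smul_mem {x : X} (hx : x ∈ symmetricCone X) {t : ℝ} (ht : 0 ≤ t) :
    t • x ∈ symmetricCone X := by
  obtain ⟨z, rfl⟩ := hx
  refine ⟨√t • z, ?_⟩
  rw [EuclideanJordanAlgebra.mul_smul, mul_comm (√t • z), EuclideanJordanAlgebra.mul_smul,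
    smul_smul, Real.mul_self_sqrt ht]

theorem inner_one_pos {x : X} (hx : x ∈ symmetricCone X) (h0 : x ≠ 0) : 0 < ⟪(1 : X), x⟫ := by
  obtain ⟨z, rfl⟩ := hx
  rw [inner_one_mul_self]
  have : z ≠ 0 := by
    rintro rfl
    exact h0 (map_zero (lmul X 0))
  positivity

variable {V : Type*} [NormedAddCommGroup V] [InnerProductSpace ℝ V]
  {P : ProperCone ℝ V} {G : X →ₗ[ℝ] V}

namespace IsLISC

theorem map_mem (hP : IsLISC P G) {x : X} (hx : x ∈ symmetricCone X) : G x ∈ P := by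
  have : G x ∈ (P : Set V) := hP.image_eq ▸ Set.mem_image_of_mem G hx
  exact this

theorem map_left_eq_zero (hP : IsLISC P G) {a b : X} (ha : a ∈ symmetricCone X)
    (hb : b ∈ symmetricCone X) (h : G (a + b) = 0) : G a = 0 := by
  refine hP.pointed _ (hP.map_mem ha) ?_
  rw [map_add] at h
  rw [neg_eq_of_add_eq_zero_right h]
  exact hP.map_mem hb

theorem map_idempotent_ne_zero (hP : IsLISC P G) {c : X} (hc : c * c = c) (h0 : c ≠ 0) :
    G c ≠ 0 := by
  intro hG
  have hclosed : IsClosed ({c : X | c * c = c ∧ c ≠ 0} ∩ {c : X | G c = 0}) :=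
    isClosed_idempotent_ne_zero.inter
      (isClosed_eq G.continuous_of_finiteDimensional continuous_const)
  have : ProperSpace X := FiniteDimensional.proper ℝ X
  obtain ⟨m, ⟨⟨hm, hm0⟩, hGm⟩, hmin⟩ := hclosed.exists_infDist_eq_dist ⟨c, ⟨hc, h0⟩, hG⟩ 0
  refine hP.map_ne_zero m ⟨hm0, hm, ?_⟩ hGm
  rintro ⟨a, b, ha0, hb0, ha, hb, rfl⟩
  have hGa : G a = 0 := hP.map_left_eq_zero ⟨a, ha.symm⟩ ⟨b, hb.symm⟩ hGm
  have hle : ‖a + b‖ ≤ ‖a‖ := by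
    have := Metric.infDist_le_dist_of_mem (x := (0 : X))
      (show a ∈ {c : X | c * c = c ∧ c ≠ 0} ∩ {c : X | G c = 0} from ⟨⟨ha, ha0⟩, hGa⟩)
    rw [hmin] at this
    simpa using this
  have h1 := inner_one_mul_self (a + b)
  rw [hm, inner_add_right] at h1
  have h2 := inner_one_mul_self a
  have h3 := inner_one_mul_self b
  rw [ha] at h2
  rw [hb] at h3
  have : 0 < ‖b‖ := norm_pos_iff.2 hb0
  nlinarith [norm_nonneg (a + b)]

theorem map_ne_zero_of_mem (hP : IsLISC P G) {x : X} (hx : x ∈ symmetricCone X) (h0 : x ≠ 0) :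
    G x ≠ 0 := by
  obtain ⟨z, rfl⟩ := hx
  have hz : z ≠ 0 := by
    rintro rfl
    exact h0 (map_zero (lmul X 0))
  obtain ⟨μ, c, hμ, hc0, hc, hzc⟩ := exists_idempotent_mul_eq_smul hz
  intro hG
  have h := hP.map_left_eq_zero (symmetricCone_smul_mem ⟨c, hc.symm⟩ (sq_nonneg μ))
    (sub_sq_smul_mem_symmetricCone hc hzc) (by rwa [add_sub_cancel])
  rw [map_smul, smul_eq_zero] at h
  exact h.elim (pow_ne_zero 2 hμ) (hP.map_idempotent_ne_zero hc hc0)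

end IsLISC

end Kernel

section Gradient

variable {V X : Type*} [NormedAddCommGroup V] [InnerProductSpace ℝ V]
  [NormedAddCommGroup X] [InnerProductSpace ℝ X] [FiniteDimensional ℝ X] [CompleteSpace X]

theorem inner_gradient_cosine (G : X →ₗ[ℝ] V) {x : X} {b : V} (hx : G x ≠ 0) (hb : b ≠ 0) (h : X) :
    ⟪h, gradient (fun x' => ⟪G x', b⟫ / (‖G x'‖ * ‖b‖)) x⟫ =
      ‖G x‖⁻¹ * ⟪G h, ‖b‖⁻¹ • b - ⟪‖G x‖⁻¹ • G x, ‖b‖⁻¹ • b⟫ • ‖G x‖⁻¹ • G x⟫ := by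
  have hGx : ‖G x‖ ≠ 0 := norm_ne_zero_iff.2 hx
  have hb' : ‖b‖ ≠ 0 := norm_ne_zero_iff.2 hb
  have hG : HasFDerivAt (fun x' => G x') G.toContinuousLinearMap x :=
    G.toContinuousLinearMap.hasFDerivAt
  have hline : HasDerivAt (fun t : ℝ => x + t • h) h 0 := by
    simpa using ((hasDerivAt_id (0 : ℝ)).smul_const h).const_add x
  have hcurve : HasDerivAt (fun t : ℝ => G (x + t • h)) (G h) 0 := by
    have := ((hasDerivAt_id (0 : ℝ)).smul_const (G h)).const_add (G x)
    simpa using this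
  have hdiff : DifferentiableAt ℝ (fun x' => ⟪G x', b⟫ / (‖G x'‖ * ‖b‖)) x := by
    simp only [div_eq_mul_inv]
    exact (hG.differentiableAt.inner ℝ (differentiableAt_const b)).fun_mul
      (((hG.differentiableAt.norm ℝ hx).mul_const _).fun_inv (mul_ne_zero hGx hb'))
  have h1 : HasDerivAt (fun t : ℝ => ⟪G (x + t • h), b⟫ / (‖G (x + t • h)‖ * ‖b‖))
      (fderiv ℝ (fun x' => ⟪G x', b⟫ / (‖G x'‖ * ‖b‖)) x h) 0 := by
    have hd : HasFDerivAt (fun x' => ⟪G x', b⟫ / (‖G x'‖ * ‖b‖))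
        (fderiv ℝ (fun x' => ⟪G x', b⟫ / (‖G x'‖ * ‖b‖)) x) (x + (0 : ℝ) • h) := by
      rw [zero_smul, add_zero]
      exact hdiff.hasFDerivAt
    exact hd.comp_hasDerivAt (0 : ℝ) hline
  have hnorm : HasDerivAt (fun t : ℝ => ‖G (x + t • h)‖) (⟪G x, G h⟫ / ‖G x‖) 0 := by
    have hs := hcurve.norm_sq.sqrt (by simpa using hGx)
    simp only [Real.sqrt_sq (norm_nonneg _)] at hs
    convert hs using 1
    simp only [zero_smul, add_zero]
    rw [mul_div_mul_left _ _ two_ne_zero]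
  have h2 := (hcurve.inner ℝ (hasDerivAt_const (0 : ℝ) b)).div (hnorm.mul_const ‖b‖)
    (by simpa using ⟨hx, hb⟩)
  have heq := h1.unique h2
  rw [real_inner_comm, ← InnerProductSpace.toDual_apply_apply (𝕜 := ℝ), toDual_gradient, heq]
  simp only [zero_smul, add_zero, inner_zero_right, zero_add, inner_sub_right, inner_smul_right,
    inner_smul_left, conj_trivial, real_inner_comm (G x) (G h)]
  field_simp

theorem gradient_traceConstraint [EuclideanJordanAlgebra X] (x : X) :
    gradient (traceConstraint (X := X)) x = 1 := by
  apply HasGradientAt.gradient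
  rw [hasGradientAt_iff_hasFDerivAt]
  exact ((InnerProductSpace.toDual ℝ X 1).hasFDerivAt (x := x)).sub_const 1

end Gradient

section Objective

variable {V X Y : Type*} [NormedAddCommGroup V] [InnerProductSpace ℝ V]
  [NormedAddCommGroup X] [InnerProductSpace ℝ X] [NormedAddCommGroup Y] [InnerProductSpace ℝ Y]
  {G : X →ₗ[ℝ] V} {H : Y →ₗ[ℝ] V}

theorem fracObjective_eq_inner (x : X) (y : Y) :
    fracObjective G H (x, y) = ⟪‖G x‖⁻¹ • G x, ‖H y‖⁻¹ • H y⟫ := by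
  simp only [fracObjective, inner_smul_left, inner_smul_right, conj_trivial]
  rw [div_eq_mul_inv, mul_inv]
  ring

theorem fracObjective_comm (x : X) (y : Y) :
    fracObjective G H (x, y) = fracObjective H G (y, x) := by
  simp only [fracObjective, real_inner_comm, mul_comm]

theorem norm_inv_norm_smul {v : V} (hv : v ≠ 0) : ‖‖v‖⁻¹ • v‖ = 1 := by
  rw [norm_smul, norm_inv, norm_norm, inv_mul_cancel₀ (norm_ne_zero_iff.2 hv)]

end Objective

section Normalization

variable {V X Y : Type*} [NormedAddCommGroup V] [InnerProductSpace ℝ V]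
  [NormedAddCommGroup X] [InnerProductSpace ℝ X] [FiniteDimensional ℝ X]
  [EuclideanJordanAlgebra X]
  [NormedAddCommGroup Y] [InnerProductSpace ℝ Y] [FiniteDimensional ℝ Y]
  [EuclideanJordanAlgebra Y]
  {P Q : ProperCone ℝ V} {G : X →ₗ[ℝ] V} {H : Y →ₗ[ℝ] V}

/-- Every unit vector of the image cone comes from a normalized element of the symmetric cone. -/
theorem exists_traceConstraint_eq_zero (hP : G '' symmetricCone X = (P : Set V)) {u : V}
    (hu : u ∈ P) (hu1 : ‖u‖ = 1) :
    ∃ x ∈ symmetricCone X, traceConstraint x = 0 ∧ G x ≠ 0 ∧ u = ‖G x‖⁻¹ • G x := by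
  obtain ⟨k, hk, rfl⟩ : u ∈ G '' symmetricCone X := hP ▸ hu
  have hk0 : k ≠ 0 := by
    rintro rfl
    simp at hu1
  have hpos := inner_one_pos hk hk0
  have hGk : G k ≠ 0 := by
    rw [← norm_ne_zero_iff, hu1]
    exact one_ne_zero
  refine ⟨⟪(1 : X), k⟫⁻¹ • k, symmetricCone_smul_mem hk (inv_nonneg.2 hpos.le), ?_, ?_, ?_⟩
  · rw [traceConstraint, inner_smul_right, inv_mul_cancel₀ hpos.ne', sub_self]
  · rw [map_smul]
    exact smul_ne_zero (inv_ne_zero hpos.ne') hGk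
  · rw [map_smul, norm_smul, hu1, mul_one, smul_smul, Real.norm_of_nonneg (inv_nonneg.2 hpos.le),
      inv_mul_cancel₀ (inv_ne_zero hpos.ne'), one_smul]

theorem ne_zero_of_traceConstraint {x : X} (h : traceConstraint x = 0) : x ≠ 0 := by
  rintro rfl
  simp [traceConstraint] at h

theorem normalized_mem_unitPairs (hP : IsLISC P G) (hQ : IsLISC Q H) {x : X} {y : Y}
    (h : (x, y) ∈ feasibleSet (symmetricCone X) (symmetricCone Y) traceConstraint
      traceConstraint) : (‖G x‖⁻¹ • G x, ‖H y‖⁻¹ • H y) ∈ unitPairs P Q :=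
  ⟨⟨P.smul_mem (hP.map_mem h.1.1) (inv_nonneg.2 (norm_nonneg _)),
    norm_inv_norm_smul (hP.map_ne_zero_of_mem h.1.1 (ne_zero_of_traceConstraint h.1.2))⟩,
   ⟨Q.smul_mem (hQ.map_mem h.2.1) (inv_nonneg.2 (norm_nonneg _)),
    norm_inv_norm_smul (hQ.map_ne_zero_of_mem h.2.1 (ne_zero_of_traceConstraint h.2.2))⟩⟩

theorem isFracSolution_iff (hP : IsLISC P G) (hQ : IsLISC Q H) {x : X} {y : Y}
    (hfeas : (x, y) ∈ feasibleSet (symmetricCone X) (symmetricCone Y) traceConstraint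
      traceConstraint) :
    IsFracSolution G H x y ↔ IsAntipodalPair P Q (‖G x‖⁻¹ • G x) (‖H y‖⁻¹ • H y) := by
  constructor
  · rintro ⟨_, hmin⟩
    refine ⟨normalized_mem_unitPairs hP hQ hfeas, ?_⟩
    rintro ⟨p, q⟩ ⟨⟨hp, hp1⟩, ⟨hq, hq1⟩⟩
    obtain ⟨x', hx', htx, _, rfl⟩ := exists_traceConstraint_eq_zero hP.image_eq hp hp1
    obtain ⟨y', hy', hty, _, rfl⟩ := exists_traceConstraint_eq_zero hQ.image_eq hq hq1
    have := hmin (show (x', y') ∈ _ from ⟨⟨hx', htx⟩, ⟨hy', hty⟩⟩)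
    simpa only [Set.mem_ofPred_eq, fracObjective_eq_inner] using this
  · rintro ⟨_, hmin⟩
    refine ⟨hfeas, ?_⟩
    rintro ⟨x', y'⟩ h
    have := hmin (normalized_mem_unitPairs hP hQ h)
    simpa only [Set.mem_ofPred_eq, fracObjective_eq_inner] using this

end Normalization

section Stationarity

variable {V X Y : Type*} [NormedAddCommGroup V] [InnerProductSpace ℝ V] [CompleteSpace V]
  [NormedAddCommGroup X] [InnerProductSpace ℝ X] [FiniteDimensional ℝ X]
  [EuclideanJordanAlgebra X]
  [NormedAddCommGroup Y] [InnerProductSpace ℝ Y] [FiniteDimensional ℝ Y]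
  [EuclideanJordanAlgebra Y]
  {P Q : ProperCone ℝ V} {G : X →ₗ[ℝ] V} {H : Y →ₗ[ℝ] V}

/-- By homogeneity, the multiplier of the trace constraint vanishes. -/
theorem exists_multiplier_iff [CompleteSpace X] (hP : G '' symmetricCone X = (P : Set V))
    {x : X} {b : V} (htr : traceConstraint x = 0) (hx : G x ≠ 0) (hb : b ≠ 0) :
    (∃ γ : ℝ,
      ⟪x, gradient (fun x' => ⟪G x', b⟫ / (‖G x'‖ * ‖b‖)) x + γ • gradient traceConstraint x⟫ = 0 ∧
      gradient (fun x' => ⟪G x', b⟫ / (‖G x'‖ * ‖b‖)) x + γ • gradient traceConstraint x ∈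
        ProperCone.innerDual (symmetricCone X)) ↔
    ‖b‖⁻¹ • b - ⟪‖G x‖⁻¹ • G x, ‖b‖⁻¹ • b⟫ • ‖G x‖⁻¹ • G x ∈
      ProperCone.innerDual (P : Set V) := by
  have hGx : ‖G x‖ ≠ 0 := norm_ne_zero_iff.2 hx
  have hGx' : 0 < ‖G x‖ := norm_pos_iff.2 hx
  have hradial : ⟪x, gradient (fun x' => ⟪G x', b⟫ / (‖G x'‖ * ‖b‖)) x⟫ = 0 := by
    rw [inner_gradient_cosine G hx hb]
    simp only [inner_sub_right, inner_smul_right, inner_smul_left, conj_trivial,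
      real_inner_self_eq_norm_sq]
    field_simp
    simp
  have htr' : ⟪x, (1 : X)⟫ = 1 := by
    rw [real_inner_comm]
    exact sub_eq_zero.1 htr
  have hdual : gradient (fun x' => ⟪G x', b⟫ / (‖G x'‖ * ‖b‖)) x ∈
      ProperCone.innerDual (symmetricCone X) ↔
      ‖b‖⁻¹ • b - ⟪‖G x‖⁻¹ • G x, ‖b‖⁻¹ • b⟫ • ‖G x‖⁻¹ • G x ∈
        ProperCone.innerDual (P : Set V) := by
    simp only [ProperCone.mem_innerDual, ← hP, Set.forall_mem_image]
    refine forall₂_congr fun k _ => ?_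
    rw [inner_gradient_cosine G hx hb]
    exact mul_nonneg_iff_of_pos_left (inv_pos.2 hGx')
  rw [← hdual, gradient_traceConstraint]
  constructor
  · rintro ⟨γ, h0, h⟩
    rw [inner_add_right, inner_smul_right, hradial, htr'] at h0
    obtain rfl : γ = 0 := by linarith
    simpa using h
  · intro h
    exact ⟨0, by simpa using hradial, by simpa using h⟩

theorem isFracStationaryPoint_iff (hP : G '' symmetricCone X = (P : Set V))
    (hQ : H '' symmetricCone Y = (Q : Set V)) {x : X} {y : Y}
    (hfeas : (x, y) ∈ feasibleSet (symmetricCone X) (symmetricCone Y) traceConstraint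
      traceConstraint) (hx : G x ≠ 0) (hy : H y ≠ 0) :
    IsFracStationaryPoint G H x y ↔
      IsCriticalPair P Q (‖G x‖⁻¹ • G x) (‖H y‖⁻¹ • H y) := by
  have : CompleteSpace X := FiniteDimensional.complete ℝ X
  have : CompleteSpace Y := FiniteDimensional.complete ℝ Y
  have h1 := exists_multiplier_iff hP hfeas.1.2 hx hy
  have h2 := exists_multiplier_iff hQ hfeas.2.2 hy hx
  have hcomm : (fun y' => fracObjective G H (x, y')) =
      fun y' => ⟪H y', G x⟫ / (‖H y'‖ * ‖G x‖) := funext fun y' => fracObjective_comm x y'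
  constructor
  · rintro ⟨_, _, _, _, hl, hr⟩
    refine ⟨?_, norm_inv_norm_smul hx, ?_, norm_inv_norm_smul hy, h1.1 hl, ?_⟩
    · exact P.smul_mem (show G x ∈ (P : Set V) from hP ▸ ⟨x, hfeas.1.1, rfl⟩)
        (inv_nonneg.2 (norm_nonneg _))
    · exact Q.smul_mem (show H y ∈ (Q : Set V) from hQ ▸ ⟨y, hfeas.2.1, rfl⟩)
        (inv_nonneg.2 (norm_nonneg _))
    · rw [hcomm] at hr
      rw [real_inner_comm]
      exact h2.1 hr
  · rintro ⟨_, _, _, _, hl, hr⟩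
    have hG : DifferentiableAt ℝ (fun p : X × Y => G p.1) (x, y) :=
      (G.toContinuousLinearMap.comp (ContinuousLinearMap.fst ℝ X Y)).differentiableAt
    have hH : DifferentiableAt ℝ (fun p : X × Y => H p.2) (x, y) :=
      (H.toContinuousLinearMap.comp (ContinuousLinearMap.snd ℝ X Y)).differentiableAt
    refine ⟨?_, ?_, ?_, hfeas, h1.2 hl, ?_⟩
    · unfold fracObjective
      simp only [div_eq_mul_inv]
      exact (hG.inner ℝ hH).fun_mul <| ((hG.norm ℝ hx).fun_mul (hH.norm ℝ hy)).fun_inv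
        (mul_ne_zero (norm_ne_zero_iff.2 hx) (norm_ne_zero_iff.2 hy))
    · exact ((InnerProductSpace.toDual ℝ X 1).differentiableAt (x := x)).sub_const 1
    · exact ((InnerProductSpace.toDual ℝ Y 1).differentiableAt (x := y)).sub_const 1
    · rw [hcomm]
      rw [real_inner_comm] at hr
      exact h2.2 hr

end Stationarity

section Antipodal

variable {V : Type*} [NormedAddCommGroup V] [InnerProductSpace ℝ V] [CompleteSpace V]
  {P Q : ProperCone ℝ V} {u v : V}

/-- First-order condition for minimizing the cosine with a fixed vector over a convex cone. -/
theorem sub_smul_mem_innerDual_of_forall_le (hu : u ∈ P) (hu1 : ‖u‖ = 1)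
    (h : ∀ p ∈ P, ‖p‖ = 1 → ⟪u, v⟫ ≤ ⟪p, v⟫) :
    v - ⟪u, v⟫ • u ∈ ProperCone.innerDual (P : Set V) := by
  have hhom : ∀ w ∈ P, ⟪u, v⟫ * ‖w‖ ≤ ⟪w, v⟫ := by
    intro w hw
    rcases eq_or_ne w 0 with rfl | hw0
    · simp
    · have h1 := h _ (P.smul_mem hw (inv_nonneg.2 (norm_nonneg w))) (norm_inv_norm_smul hw0)
      rw [inner_smul_left, conj_trivial, inv_mul_eq_div, le_div_iff₀ (norm_pos_iff.2 hw0)] at h1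
      exact h1
  intro p hp
  have hd : HasDerivAt (fun t : ℝ => ⟪u + t • p, v⟫ - ⟪u, v⟫ * ‖u + t • p‖)
      (⟪p, v⟫ - ⟪u, v⟫ * ⟪u, p⟫) 0 := by
    have hc : HasDerivAt (fun t : ℝ => u + t • p) p 0 := by
      simpa using ((hasDerivAt_id (0 : ℝ)).smul_const p).const_add u
    have hs := hc.norm_sq.sqrt (by simp [hu1])
    simp only [Real.sqrt_sq (norm_nonneg _)] at hs
    have := (hc.inner ℝ (hasDerivAt_const (0 : ℝ) v)).fun_sub (hs.const_mul ⟪u, v⟫)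
    simpa [hu1] using this
  have h0 : 0 ≤ ⟪p, v⟫ - ⟪u, v⟫ * ⟪u, p⟫ := by
    have hlim := (hasDerivAt_iff_tendsto_slope.1 hd).mono_left
      (nhdsWithin_mono (s := Set.Ioi 0) 0 (fun t (ht : 0 < t) => ht.ne'))
    refine ge_of_tendsto hlim (Filter.eventually_of_mem self_mem_nhdsWithin fun t ht => ?_)
    have ht' : (0 : ℝ) < t := ht
    rw [slope_def_field]
    simp only [zero_smul, add_zero, hu1, mul_one, sub_self, sub_zero]
    exact div_nonneg (sub_nonneg.2 (hhom _ (P.add_mem hu (P.smul_mem hp ht'.le)))) ht'.le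
  change 0 ≤ ⟪p, v - ⟪u, v⟫ • u⟫
  rwa [inner_sub_right, inner_smul_right, real_inner_comm u p]

theorem IsAntipodalPair.isCriticalPair (h : IsAntipodalPair P Q u v) : IsCriticalPair P Q u v := by
  obtain ⟨⟨⟨hu, hu1⟩, ⟨hv, hv1⟩⟩, hmin⟩ := h
  refine ⟨hu, hu1, hv, hv1, ?_, ?_⟩
  · exact sub_smul_mem_innerDual_of_forall_le hu hu1 fun p hp hp1 =>
      hmin (show (p, v) ∈ unitPairs P Q from ⟨⟨hp, hp1⟩, ⟨hv, hv1⟩⟩)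
  · rw [real_inner_comm]
    refine sub_smul_mem_innerDual_of_forall_le hv hv1 fun q hq hq1 => ?_
    rw [real_inner_comm, real_inner_comm u q]
    exact hmin (show (u, q) ∈ unitPairs P Q from ⟨⟨hu, hu1⟩, ⟨hq, hq1⟩⟩)

end Antipodal

theorem corollary3p6 {V X Y : Type*}
    [NormedAddCommGroup V] [InnerProductSpace ℝ V] [FiniteDimensional ℝ V]
    [NormedAddCommGroup X] [InnerProductSpace ℝ X] [FiniteDimensional ℝ X]
    [EuclideanJordanAlgebra X]
    [NormedAddCommGroup Y] [InnerProductSpace ℝ Y] [FiniteDimensional ℝ Y]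
    [EuclideanJordanAlgebra Y]
    (P Q : ProperCone ℝ V) (G : X →ₗ[ℝ] V) (H : Y →ₗ[ℝ] V)
    (hP : IsLISC P G) (hQ : IsLISC Q H) :
    (∀ (x : X) (y : Y), IsFracStationaryPoint G H x y →
      IsCriticalPair P Q (‖G x‖⁻¹ • G x) (‖H y‖⁻¹ • H y)) ∧
    (∀ (x : X) (y : Y), IsFracSolution G H x y →
      IsAntipodalPair P Q (‖G x‖⁻¹ • G x) (‖H y‖⁻¹ • H y)) ∧
    (∀ u v : V, IsCriticalPair P Q u v →
      ∃ (x : X) (y : Y), IsFracStationaryPoint G H x y ∧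
        u = ‖G x‖⁻¹ • G x ∧ v = ‖H y‖⁻¹ • H y) ∧
    (∀ u v : V, IsAntipodalPair P Q u v →
      ∃ (x : X) (y : Y), IsFracSolution G H x y ∧ IsFracStationaryPoint G H x y ∧
        u = ‖G x‖⁻¹ • G x ∧ v = ‖H y‖⁻¹ • H y) := by
  have hne : ∀ {x : X} {y : Y}, (x, y) ∈ feasibleSet (symmetricCone X) (symmetricCone Y)
      traceConstraint traceConstraint → G x ≠ 0 ∧ H y ≠ 0 := fun h =>
    ⟨hP.map_ne_zero_of_mem h.1.1 (ne_zero_of_traceConstraint h.1.2),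
      hQ.map_ne_zero_of_mem h.2.1 (ne_zero_of_traceConstraint h.2.2)⟩
  have hlift : ∀ u v : V, IsCriticalPair P Q u v → ∃ (x : X) (y : Y),
      (x, y) ∈ feasibleSet (symmetricCone X) (symmetricCone Y) traceConstraint traceConstraint ∧
      IsFracStationaryPoint G H x y ∧ u = ‖G x‖⁻¹ • G x ∧ v = ‖H y‖⁻¹ • H y := by
    intro u v h
    obtain ⟨x, hx, htx, hGx, rfl⟩ :=
      exists_traceConstraint_eq_zero hP.image_eq h.mem_left h.norm_left
    obtain ⟨y, hy, hty, hHy, rfl⟩ :=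
      exists_traceConstraint_eq_zero hQ.image_eq h.mem_right h.norm_right
    have hfeas : (x, y) ∈ feasibleSet (symmetricCone X) (symmetricCone Y) traceConstraint
      traceConstraint := ⟨⟨hx, htx⟩, ⟨hy, hty⟩⟩
    exact ⟨x, y, hfeas,
      (isFracStationaryPoint_iff hP.image_eq hQ.image_eq hfeas hGx hHy).2 h, rfl, rfl⟩
  refine ⟨fun x y h => ?_, fun x y h => (isFracSolution_iff hP hQ h.1).1 h, fun u v h => ?_,
    fun u v h => ?_⟩
  · have hfeas : (x, y) ∈ feasibleSet (symmetricCone X) (symmetricCone Y) traceConstraint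
      traceConstraint := h.feasible
    exact (isFracStationaryPoint_iff hP.image_eq hQ.image_eq hfeas (hne hfeas).1
      (hne hfeas).2).1 h
  · obtain ⟨x, y, _, h⟩ := hlift u v h
    exact ⟨x, y, h⟩
  · obtain ⟨x, y, hfeas, hst, rfl, rfl⟩ := hlift u v h.isCriticalPair
    exact ⟨x, y, (isFracSolution_iff hP hQ hfeas).2 h, hst, rfl, rfl⟩
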